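/- Let $X$ be a continuum (a non-empty compact connected metric space), let $h\colon X\to X$ be a homeomorphism, let $\varphi\colon X\to X$ be a continuous surjection that commutes with $h$, and let $a,b\ge 0$, $n,m\ge 1$ be integers. Put $f=h^a\circ\varphi^n$ and $g=h^b\circ\varphi^m$ (such $f,g$ are called kin). Let $$\varprojlim(X,f)=\{(x_0,x_1,x_2,\ldots)\in X^{\{0,1,2,\ldots\}}: f(x_{i})=x_{i-1}\text{ for all } i\ge 1\},$$ with the topology induced by the product topology and any metric compatible with it, and let $G\colon\varprojlim(X,f)\to\varprojlim(X,f)$ be the diagonal map $G(x_0,x_1,x_2,\ldots)=(g(x_1),g(x_2),\ldots)$. For $k\in\mathbb Z$ let $\varphi^{k}$ be the $k$-th iterate of $\varphi$ if $k\ge 0$, and the set-valued function $x\mapsto\{y\in X:\varphi^{-k}(y)=x\}$ if $k<0$. Then $h^{b-a}\circ\varphi^{m-n}$ is an upper semi-continuous set-valued function on $X$ (its values are non-empty and closed and its graph is closed), and $$\mathrm{Ent}(G)=\mathrm{Ent}(h^{b-a}\circ\varphi^{m-n}).$$ Here the entropy of an upper semi-continuous set-valued function $F$ on a compact metric space $(Y,d)$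 (a map being identified with a single-valued function) is $$\mathrm{Ent}(F)=\lim_{\varepsilon\to 0}\limsup_{N\to\infty}\frac1N\log s_{N,\varepsilon}(F)\in[0,+\infty],$$ where $s_{N,\varepsilon}(F)$ is the largest cardinality of a set $S$ of $N$-tuples $(x_1,\ldots,x_N)\in Y^N$ with $x_{i+1}\in F(x_i)$ for $1\le i<N$, such that any two distinct elements $(x_i),(y_i)$ of $S$ satisfy $d(x_i,y_i)\ge\varepsilon$ for some $i$. -/

import Mathlib

open Filter Topology

namespace KinEntropy

/-! ### Set-valued functions -/

/-- A single-valued function, regarded as a set-valued one. -/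
def single {X : Type*} (f : X → X) : X → Set X := fun x => {f x}

/-- Composition `F ∘ G` of set-valued functions: `(F ∘ G)(x)` is the union of `F y` over
`y ∈ G x`. -/
def svComp {X : Type*} (F G : X → Set X) : X → Set X := fun x => ⋃ y ∈ G x, F y

/-- The integer power of a map `φ`, as a set-valued function: the iterate `x ↦ {φ^k (x)}` for an
exponent `k ≥ 0`, and the preimage `x ↦ {y | φ^k (y) = x}` for an exponent `-k < 0`. -/
def svZPow {X : Type*} (φ : X → X) : ℤ → X → Set X
  | Int.ofNat k => single φ^[k]
  | Int.negSucc k => fun x => {y | φ^[k + 1] y = x}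

/-- `F : X → 2^X` is an upper semi-continuous set-valued function: its values are non-empty closed
sets and its graph is closed. -/
structure IsUSC {X : Type*} [TopologicalSpace X] (F : X → Set X) : Prop where
  nonempty : ∀ x, (F x).Nonempty
  isClosed : ∀ x, IsClosed (F x)
  isClosed_graph : IsClosed {p : X × X | p.2 ∈ F p.1}

/-! ### Topological entropy -/

/-- The `n`-orbits of `F`: the tuples with `x_{i+1} ∈ F (x_i)` for consecutive indices. -/
def orb {X : Type*} (F : X → Set X) (n : ℕ) : Set (Fin n → X) :=
  {x | ∀ i j : Fin n, (j : ℕ) = (i : ℕ) + 1 → x j ∈ F (x i)}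

/-- `S` is an `(n, ε)`-separated set of `n`-orbits of `F`: any two distinct elements of `S` are at
distance at least `ε` in some coordinate. -/
def IsSeparated {X : Type*} [PseudoMetricSpace X] (F : X → Set X) (n : ℕ) (ε : ℝ)
    (S : Set (Fin n → X)) : Prop :=
  S ⊆ orb F n ∧ S.Pairwise fun x y => ∃ i, ε ≤ dist (x i) (y i)

/-- The largest cardinality of an `(n, ε)`-separated set of `n`-orbits. -/
noncomputable def sepNum {X : Type*} [PseudoMetricSpace X] (F : X → Set X) (n : ℕ) (ε : ℝ) : ℕ∞ :=
  ⨆ (S : Set (Fin n → X)) (_ : IsSeparated F n ε S), S.encard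

/-- The growth rate `limsup_n (1/n) log s_{n,ε}(F)` at scale `ε`. -/
noncomputable def entAt {X : Type*} [PseudoMetricSpace X] (F : X → Set X) (ε : ℝ) : EReal :=
  limsup (fun n : ℕ => ENNReal.log (sepNum F n ε : ENNReal) / (n : EReal)) atTop

/-- The entropy of `F`. The limit as `ε → 0` is written as a supremum over `ε > 0`;
`tendsto_entAt` below says that this is the limit. -/
noncomputable def ent {X : Type*} [PseudoMetricSpace X] (F : X → Set X) : EReal :=
  ⨆ (ε : ℝ) (_ : 0 < ε), entAt F ε

theorem entAt_antitone {X : Type*} [PseudoMetricSpace X] (F : X → Set X) :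
    Antitone (entAt F) := by
  intro ε δ h
  refine limsup_le_limsup (Eventually.of_forall fun n => ?_)
  refine EReal.div_le_div_right_of_nonneg (by positivity) (ENNReal.log_monotone ?_)
  refine ENat.toENNReal_le.2 (iSup_mono fun S => iSup_mono' fun hS => ?_)
  exact ⟨⟨hS.1, hS.2.imp fun _ _ ⟨i, hi⟩ => ⟨i, h.trans hi⟩⟩, le_rfl⟩

theorem tendsto_entAt {X : Type*} [PseudoMetricSpace X] (F : X → Set X) :
    Tendsto (entAt F) (𝓝[>] 0) (𝓝 (ent F)) := by
  have := (entAt_antitone F).tendsto_nhdsGT 0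
  rwa [sSup_image] at this

/-! ### Inverse limits and diagonal maps -/

/-- The inverse limit of `(X, f)`: the sequences with `f (x_{i+1}) = x_i` for all `i ≥ 0`. -/
def InvLimit {X : Type*} (f : X → X) : Type _ := {x : ℕ → X // ∀ i, f (x (i + 1)) = x i}

/-- The inverse limit carries the subspace topology of the product topology. -/
instance InvLimit.topology {X : Type*} [TopologicalSpace X] (f : X → X) :
    TopologicalSpace (InvLimit f) :=
  TopologicalSpace.induced (fun x : InvLimit f => x.1) Pi.topologicalSpace

/-- The diagonal map `(x_0, x_1, x_2, …) ↦ (g (x_1), g (x_2), …)` on the inverse limit. -/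
def diagonal {X : Type*} (f g : X → X) (hfg : Function.Commute f g) : InvLimit f → InvLimit f :=
  fun x => ⟨fun i => g (x.1 (i + 1)), fun i => by rw [hfg (x.1 (i + 1 + 1)), x.2 (i + 1)]⟩

theorem kin_commute {X : Type*} [TopologicalSpace X] {f g φ : X → X} {h : X ≃ₜ X} {a b n m : ℕ}
    (hφh : Function.Commute φ h) (hf : f = (h ^ a : X ≃ₜ X) ∘ φ^[n])
    (hg : g = (h ^ b : X ≃ₜ X) ∘ φ^[m]) : Function.Commute f g := by
  have key : ∀ k : ℕ, ((h ^ k : X ≃ₜ X) : X → X) = h^[k] := by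
    intro k
    induction k with
    | zero => rfl
    | succ k ih => rw [pow_succ, Function.iterate_succ, ← ih]; rfl
  rw [key] at hf hg
  subst hf hg
  have h1 : Function.Commute (h^[a]) (h^[b]) :=
    Function.Commute.iterate_iterate (Function.Commute.refl h) a b
  have h2 : Function.Commute (φ^[n]) (φ^[m]) :=
    Function.Commute.iterate_iterate (Function.Commute.refl φ) n m
  have h3 := (hφh.iterate_iterate n b)
  have h4 := (hφh.iterate_iterate m a)
  exact (h1.comp_right h4.symm).comp_left (h3.comp_right h2)

end KinEntropy

namespace KinEntropy

/-! ### Comparing entropies along maps of orbits -/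

/-! Write `F` for the set-valued function and `G` for the diagonal map. Since `g x ∈ F (f x)`, every
coordinate projection of the inverse limit sends orbits of `G` to orbits of `F`. A coordinate
determines all earlier ones, so by compactness one far enough out separates points at a given scale;
hence `ent_le_of_proj` bounds the entropy of `G` by that of `F`. Conversely, orbits of `F` lift
along the zeroth projection, which is onto because `f` is, and `ent_le_of_lift` applies. If `n ≤ m`,
`F` is a map and `G` lifts it, so one lifts the first point and iterates `G`. If `m < n`, `F` is the
inverse of a map `H` whose induced map is a right inverse of `G`, so one lifts the last point and
iterates `H` backwards in time. -/

theorem entAt_le_entAt {A B : Type*} [PseudoMetricSpace A] [PseudoMetricSpace B]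
    {F : A → Set A} {F' : B → Set B} {ε δ : ℝ} (hδ : 0 < δ) (T : ∀ N : ℕ, orb F N → orb F' N)
    (hsep : ∀ N (x y : orb F N), (∃ i, ε ≤ dist (x.1 i) (y.1 i)) →
      ∃ i, δ ≤ dist ((T N x).1 i) ((T N y).1 i)) :
    entAt F ε ≤ entAt F' δ := by
  refine limsup_le_limsup (Eventually.of_forall fun N => ?_)
  refine EReal.div_le_div_right_of_nonneg (by positivity) (ENNReal.log_monotone ?_)
  refine ENat.toENNReal_le.2 (iSup₂_le fun S hS => ?_)
  let t : S → Fin N → B := fun x => T N ⟨x, hS.1 x.2⟩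
  have ht : ∀ x y : S, x ≠ y → ∃ i, δ ≤ dist (t x i) (t y i) := fun x y hxy =>
    hsep N _ _ (hS.2 x.2 y.2 (Subtype.coe_ne_coe.2 hxy))
  have hinj : Function.Injective t := by
    intro x y hxy
    by_contra hne
    obtain ⟨i, hi⟩ := ht x y hne
    rw [hxy, dist_self] at hi
    exact hi.not_gt hδ
  rw [← ENat.card_coe_set_eq]
  refine hinj.encard_range.trans (le_iSup₂_of_le (Set.range t) ⟨?_, ?_⟩ le_rfl)
  · rintro _ ⟨x, rfl⟩
    exact Subtype.property _
  · rintro _ ⟨x, rfl⟩ _ ⟨y, rfl⟩ hxy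
    exact ht x y fun h => hxy (h ▸ rfl)

/-- If the orbits of `F` lift to orbits of `F'` along a continuous map of a compact space, then
`F` has at most the entropy of `F'`. -/
theorem ent_le_of_lift {X Y : Type*} [PseudoMetricSpace X] [PseudoMetricSpace Y] [CompactSpace Y]
    {F : X → Set X} {F' : Y → Set Y} {p : Y → X} (hp : Continuous p)
    (hlift : ∀ N, ∀ x ∈ orb F N, ∃ y ∈ orb F' N, ∀ i, p (y i) = x i) :
    ent F ≤ ent F' := by
  refine iSup₂_le fun ε hε => ?_
  obtain ⟨δ, hδ, hpδ⟩ :=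
    Metric.uniformContinuous_iff.1 (CompactSpace.uniformContinuous_of_continuous hp) ε hε
  choose L hL hpL using hlift
  refine le_iSup₂_of_le δ hδ (entAt_le_entAt hδ (fun N x => ⟨L N x.1 x.2, hL N x.1 x.2⟩) ?_)
  rintro N x y ⟨i, hi⟩
  refine ⟨i, not_lt.1 fun hlt => hi.not_gt ?_⟩
  simpa only [hpL] using hpδ hlt

/-- If a sequence of continuous maps of a compact space, each determined by the next one, separates
points and sends orbits of `F'` to orbits of `F`, then `F'` has at most the entropy of `F`. -/
theorem ent_le_of_proj {X Y : Type*} [MetricSpace X] [PseudoMetricSpace Y] [CompactSpace Y]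
    {F : X → Set X} {F' : Y → Set Y} {p : ℕ → Y → X} (hp : ∀ k, Continuous (p k))
    (hmono : ∀ k x y, p (k + 1) x = p (k + 1) y → p k x = p k y)
    (hinj : ∀ x y, (∀ k, p k x = p k y) → x = y)
    (horb : ∀ k x, ∀ y ∈ F' x, p k y ∈ F (p k x)) :
    ent F' ≤ ent F := by
  refine iSup₂_le fun ε hε => ?_
  have hC : IsCompact {q : Y × Y | ε ≤ dist q.1 q.2} :=
    (isClosed_le continuous_const continuous_dist).isCompact
  have hopen : ∀ k, IsOpen {q : Y × Y | p k q.1 ≠ p k q.2} := fun k =>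
    isOpen_ne_fun ((hp k).comp continuous_fst) ((hp k).comp continuous_snd)
  have hmono' : Monotone fun k => {q : Y × Y | p k q.1 ≠ p k q.2} :=
    monotone_nat_of_le_succ fun k q hq h => hq (hmono k _ _ h)
  -- The increasing open sets of pairs separated by coordinate `k` cover the compact set of
  -- `ε`-distant pairs, so one `k` serves them all.
  obtain ⟨k, hk⟩ := hC.elim_directed_cover _ hopen (fun q hq => by
    by_contra hcon
    simp only [ne_eq, Set.mem_iUnion, Set.mem_ofPred_eq, not_exists, not_not] at hcon hq
    rw [hinj _ _ hcon, dist_self] at hq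
    exact hε.not_ge hq) hmono'.directed_le
  obtain ⟨δ, hδ, hkδ⟩ : ∃ δ > 0, ∀ x y, ε ≤ dist x y → δ ≤ dist (p k x) (p k y) := by
    rcases Set.eq_empty_or_nonempty {q : Y × Y | ε ≤ dist q.1 q.2} with h0 | hne
    · exact ⟨1, one_pos, fun x y h => absurd (show (x, y) ∈ {q : Y × Y | ε ≤ dist q.1 q.2} from h)
        (h0 ▸ Set.notMem_empty _)⟩
    · obtain ⟨q, hq, hmin⟩ := hC.exists_isMinOn hne
        (((hp k).comp continuous_fst).dist ((hp k).comp continuous_snd)).continuousOn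
      exact ⟨_, dist_pos.2 (hk hq), fun x y h => hmin (show (x, y) ∈ _ from h)⟩
  refine le_iSup₂_of_le δ hδ (entAt_le_entAt hδ
    (fun N x => ⟨fun i => p k (x.1 i), fun i j hij => horb k _ _ (x.2 i j hij)⟩) ?_)
  exact fun N x y ⟨i, hi⟩ => ⟨i, hkδ _ _ hi⟩

/-! ### Lifting orbits -/

theorem exists_lift_of_forward {X Y : Type*} {F : X → Set X} {G : Y → Y} {p : Y → X}
    (hp : Function.Surjective p) (hF : ∀ y, ∀ z ∈ F (p y), z = p (G y)) (N : ℕ) :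
    ∀ x ∈ orb F N, ∃ y ∈ orb (single G) N, ∀ i, p (y i) = x i := by
  intro x hx
  rcases N with _ | N
  · exact ⟨fun i => i.elim0, fun i => i.elim0, fun i => i.elim0⟩
  obtain ⟨w, hw⟩ := hp (x 0)
  refine ⟨fun i => G^[i] w, fun i j hij => ?_, fun i => ?_⟩
  · simp only [hij, Function.iterate_succ_apply']
    rfl
  · induction i using Fin.induction with
    | zero => exact hw
    | succ i ih =>
      have := hx i.castSucc i.succ (by simp)
      rw [← ih] at this
      simpa [Function.iterate_succ_apply'] using (hF _ _ this).symm

theorem exists_lift_of_backward {X Y : Type*} {F : X → Set X} {G G' : Y → Y} {p : Y → X}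
    (hp : Function.Surjective p) (hG : Function.RightInverse G' G)
    (hF : ∀ y x, p y ∈ F x → p (G' y) = x) (N : ℕ) :
    ∀ x ∈ orb F N, ∃ y ∈ orb (single G) N, ∀ i, p (y i) = x i := by
  intro x hx
  rcases N with _ | N
  · exact ⟨fun i => i.elim0, fun i => i.elim0, fun i => i.elim0⟩
  obtain ⟨w, hw⟩ := hp (x (Fin.last N))
  -- The orbit is built from its last point; each `G'` undoes one step of `G`.
  refine ⟨fun i => G'^[N - i] w, fun i j hij => ?_, fun i => ?_⟩
  · have : N - (i : ℕ) = N - j + 1 := by omega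
    simp only [this, Function.iterate_succ_apply']
    exact (hG _).symm
  · induction i using Fin.reverseInduction with
    | last => simpa using hw
    | cast i ih =>
      have h1 := hx i.castSucc i.succ (by simp)
      rw [← ih] at h1
      have h2 : N - (i.castSucc : ℕ) = N - (i.succ : ℕ) + 1 := by
        simp only [Fin.val_castSucc, Fin.val_succ]; omega
      simpa only [h2, Function.iterate_succ_apply'] using hF _ _ h1

/-! ### Inverse limits -/

theorem continuous_proj {X : Type*} [TopologicalSpace X] (f : X → X) (k : ℕ) :
    Continuous fun x : InvLimit f => x.1 k :=
  (continuous_apply k).comp continuous_induced_dom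

theorem compactSpace_invLimit {X : Type*} [TopologicalSpace X] [T2Space X] [CompactSpace X]
    {f : X → X} (hf : Continuous f) : CompactSpace (InvLimit f) := by
  have hcl : IsClosed {x : ℕ → X | ∀ i, f (x (i + 1)) = x i} := by
    simp only [Set.ofPred_forall]
    exact isClosed_iInter fun i =>
      isClosed_eq (hf.comp (continuous_apply _)) (continuous_apply _)
  exact isCompact_iff_compactSpace.1 hcl.isCompact

theorem proj_zero_surjective {X : Type*} {f : X → X} (hf : Function.Surjective f) :
    Function.Surjective fun x : InvLimit f => x.1 0 := by
  intro x
  refine ⟨⟨fun i => (Function.surjInv hf)^[i] x, fun i => ?_⟩, rfl⟩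
  simp only [Function.iterate_succ_apply', Function.surjInv_eq hf]

/-- The map of the inverse limit induced by a map commuting with the bonding map. -/
def InvLimit.map {X : Type*} {f H : X → X} (hfH : Function.Commute f H) :
    InvLimit f → InvLimit f :=
  fun x => ⟨fun i => H (x.1 i), fun i => by rw [hfH, x.2 i]⟩

/-- Coordinate `k` of the image of `x` is `g (x.1 (k + 1))`, while `x.1 k` is `f (x.1 (k + 1))`, so
`hF` relates the two. -/
theorem ent_diagonal_le {X : Type*} [MetricSpace X] [CompactSpace X] {f g : X → X}
    (hf : Continuous f) (hfg : Function.Commute f g) (D : MetricSpace (InvLimit f))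
    (hD : D.toPseudoMetricSpace.toUniformSpace.toTopologicalSpace = InvLimit.topology f)
    {F : X → Set X} (hF : ∀ x, g x ∈ F (f x)) :
    @ent (InvLimit f) D.toPseudoMetricSpace (single (diagonal f g hfg)) ≤ ent F := by
  have hc := compactSpace_invLimit hf
  have hp := continuous_proj f
  rw [← hD] at hc hp
  refine ent_le_of_proj (p := fun k x => x.1 k) hp (fun k x y h => ?_) (fun x y h => ?_) ?_
  · rw [← x.2 k, ← y.2 k, h]
  · exact Subtype.ext (funext h)
  · rintro k x _ rfl
    rw [← x.2 k]
    exact hF _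

theorem le_ent_diagonal {X : Type*} [MetricSpace X] [CompactSpace X] {f g : X → X}
    (hf : Continuous f) (hfg : Function.Commute f g) (D : MetricSpace (InvLimit f))
    (hD : D.toPseudoMetricSpace.toUniformSpace.toTopologicalSpace = InvLimit.topology f)
    {F : X → Set X} (hlift : ∀ N, ∀ x ∈ orb F N,
      ∃ y ∈ orb (single (diagonal f g hfg)) N, ∀ i, (y i).1 0 = x i) :
    ent F ≤ @ent (InvLimit f) D.toPseudoMetricSpace (single (diagonal f g hfg)) := by
  have hc := compactSpace_invLimit hf
  have hp := continuous_proj f 0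
  rw [← hD] at hc hp
  exact ent_le_of_lift hp hlift

/-! ### Integer powers of a map composed with a homeomorphism -/

theorem svComp_single_svZPow_ofNat {X : Type*} (u φ : X → X) (d : ℕ) :
    svComp (single u) (svZPow φ d) = single (u ∘ φ^[d]) := by
  ext x y
  change y ∈ ⋃ z ∈ ({φ^[d] x} : Set X), ({u z} : Set X) ↔ y ∈ ({u (φ^[d] x)} : Set X)
  simp

theorem mem_svComp_single_svZPow_neg {X : Type*} [TopologicalSpace X] (u : X ≃ₜ X) (φ : X → X)
    {d : ℕ} (hd : d ≠ 0) (x y : X) :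
    y ∈ svComp (single u) (svZPow φ (-(d : ℤ))) x ↔ φ^[d] (u.symm y) = x := by
  obtain ⟨d, rfl⟩ := Nat.exists_eq_succ_of_ne_zero hd
  change y ∈ ⋃ z ∈ {z | φ^[d + 1] z = x}, ({u z} : Set X) ↔ _
  simp only [Set.mem_iUnion, Set.mem_ofPred_eq, Set.mem_singleton_iff, exists_prop]
  constructor
  · rintro ⟨z, hz, rfl⟩
    simpa using hz
  · exact fun h => ⟨u.symm y, h, by simp⟩

theorem isUSC_single {X : Type*} [TopologicalSpace X] [T2Space X] {f : X → X}
    (hf : Continuous f) : IsUSC (single f) where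
  nonempty _ := Set.singleton_nonempty _
  isClosed _ := isClosed_singleton
  isClosed_graph := isClosed_eq continuous_snd (hf.comp continuous_fst)

theorem isUSC_of_mem_iff {X : Type*} [TopologicalSpace X] [T2Space X] {F : X → Set X} {H : X → X}
    (hH : Continuous H) (hsurj : Function.Surjective H) (hF : ∀ x y, y ∈ F x ↔ H y = x) :
    IsUSC F where
  nonempty x := (hsurj x).imp fun y hy => (hF x y).2 hy
  isClosed x := by
    have : F x = {y | H y = x} := Set.ext fun y => hF x y
    rw [this]
    exact isClosed_eq hH continuous_const
  isClosed_graph := by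
    simp only [hF]
    exact isClosed_eq (hH.comp continuous_snd) continuous_fst

theorem commute_zpow {X : Type*} [TopologicalSpace X] {φ : X → X} {h : X ≃ₜ X}
    (hφh : Function.Commute φ h) (k : ℤ) : Function.Commute φ (h ^ k : X ≃ₜ X) := by
  have hinv : Function.Commute φ (h⁻¹ : X ≃ₜ X) := fun x => h.injective <| by
    rw [← hφh]
    exact (congrArg φ (h.apply_symm_apply x)).trans (h.apply_symm_apply _).symm
  induction k with
  | zero => exact fun x => rfl
  | succ k ih =>
    rw [zpow_add_one]
    exact ih.comp_right hφh
  | pred k ih =>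
    rw [zpow_sub_one]
    exact ih.comp_right hinv

end KinEntropy

open KinEntropy

theorem mainTheorem3 {X : Type*} [MetricSpace X] [CompactSpace X] [ConnectedSpace X]
    (f g φ : X → X) (h : X ≃ₜ X) (hφ_cont : Continuous φ) (hφ_onto : Function.Surjective φ)
    (hφh : Function.Commute φ h) (a b n m : ℕ) (hn : 1 ≤ n) (hm : 1 ≤ m)
    (hf : f = (h ^ a : X ≃ₜ X) ∘ φ^[n]) (hg : g = (h ^ b : X ≃ₜ X) ∘ φ^[m])
    (D : MetricSpace (KinEntropy.InvLimit f))
    (hD : D.toPseudoMetricSpace.toUniformSpace.toTopologicalSpace =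
      KinEntropy.InvLimit.topology f) :
    KinEntropy.IsUSC
        (KinEntropy.svComp (KinEntropy.single (h ^ ((b : ℤ) - (a : ℤ)) : X ≃ₜ X))
          (KinEntropy.svZPow φ ((m : ℤ) - (n : ℤ)))) ∧
      @KinEntropy.ent (KinEntropy.InvLimit f) D.toPseudoMetricSpace
          (KinEntropy.single
            (KinEntropy.diagonal f g (KinEntropy.kin_commute hφh hf hg))) =
        KinEntropy.ent
          (KinEntropy.svComp (KinEntropy.single (h ^ ((b : ℤ) - (a : ℤ)) : X ≃ₜ X))
            (KinEntropy.svZPow φ ((m : ℤ) - (n : ℤ)))) := by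
  have hv : Function.Commute φ (h ^ a : X ≃ₜ X) := by
    simpa only [zpow_natCast] using commute_zpow hφh a
  have hu := commute_zpow hφh (-((b : ℤ) - a))
  rw [zpow_neg] at hu
  have huv : h ^ b = h ^ ((b : ℤ) - a) * h ^ a := by
    rw [← zpow_natCast h a, ← zpow_add, sub_add_cancel, zpow_natCast]
  have huv' : h ^ b = h ^ a * h ^ ((b : ℤ) - a) := by
    rw [← zpow_natCast h a, ← zpow_add, add_sub_cancel, zpow_natCast]
  have hfg := kin_commute hφh hf hg
  have hfc : Continuous f := hf ▸ (Homeomorph.continuous _).comp (hφ_cont.iterate n)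
  have hfs : Function.Surjective f := hf ▸ (Homeomorph.surjective _).comp (hφ_onto.iterate n)
  generalize h ^ ((b : ℤ) - a) = u at *
  have hgv : ∀ x, g x = u ((h ^ a : X ≃ₜ X) (φ^[m] x)) := fun x => by rw [hg, huv]; rfl
  have hfv : ∀ x, f x = (h ^ a : X ≃ₜ X) (φ^[n] x) := fun x => by rw [hf]; rfl
  have huv_comm : ∀ x, u ((h ^ a : X ≃ₜ X) x) = (h ^ a : X ≃ₜ X) (u x) := fun x =>
    DFunLike.congr_fun (huv.symm.trans huv') x
  have hvi := fun d => hv.iterate_left d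
  rcases le_or_gt n m with hnm | hmn
  · obtain ⟨d, rfl⟩ := Nat.exists_eq_add_of_le' hnm
    have hk : ((d + n : ℕ) : ℤ) - n = d := by push_cast; ring
    rw [hk, svComp_single_svZPow_ofNat]
    have hgf : ∀ x, g x = (u ∘ φ^[d]) (f x) := fun x => by
      rw [hgv, hfv, Function.comp_apply, hvi d, Function.iterate_add_apply]
    refine ⟨isUSC_single (u.continuous.comp (hφ_cont.iterate d)), le_antisymm
      (ent_diagonal_le hfc hfg D hD hgf) (le_ent_diagonal hfc hfg D hD
        (exists_lift_of_forward (p := fun x : InvLimit f => x.1 0) (proj_zero_surjective hfs) ?_))⟩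
    rintro y _ rfl
    change (u ∘ φ^[d]) (y.1 0) = g (y.1 1)
    rw [hgf, y.2 0]
  · obtain ⟨d, rfl⟩ := Nat.exists_eq_add_of_le hmn.le
    have hd : d ≠ 0 := by omega
    have hk : (m : ℤ) - ((m + d : ℕ) : ℤ) = -(d : ℤ) := by push_cast; ring
    rw [hk]
    have hmem := mem_svComp_single_svZPow_neg u φ hd
    have hfgH : ∀ x, φ^[d] (u.symm (g x)) = f x := fun x => by
      rw [hgv, u.symm_apply_apply, hvi d, ← Function.iterate_add_apply, hfv, add_comm]
    have huinv : Function.Commute φ^[m + d] u.symm := Function.Commute.iterate_left hu _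
    have hgH : ∀ x, g (φ^[d] (u.symm x)) = f x := fun x => by
      rw [hgv, ← Function.iterate_add_apply, huinv, huv_comm, u.apply_symm_apply, hfv]
    -- With `H = φ^[d] ∘ u.symm`, both `H ∘ g` and `g ∘ H` equal `f`, so `f ∘ H = H ∘ g ∘ H = H ∘
    -- f`.
    have hfH : Function.Commute f (φ^[d] ∘ u.symm) := fun x =>
      (hfgH _).symm.trans (congrArg (φ^[d] ∘ u.symm) (hgH x))
    refine ⟨isUSC_of_mem_iff ((hφ_cont.iterate d).comp u.symm.continuous)
      ((hφ_onto.iterate d).comp u.symm.surjective) hmem, le_antisymm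
      (ent_diagonal_le hfc hfg D hD fun x => (hmem _ _).2 (hfgH x))
      (le_ent_diagonal hfc hfg D hD
        (exists_lift_of_backward (p := fun x : InvLimit f => x.1 0) (G' := InvLimit.map hfH)
          (proj_zero_surjective hfs) (fun x => Subtype.ext (funext fun i => ?_))
          fun y x hyx => (hmem _ _).1 hyx))⟩
    exact (hgH _).trans (x.2 i)
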